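/- Let $\varepsilon,\omega,b,s\in\mathbb R$ with $1+2\varepsilon\omega>0$, and let $\tilde u:\mathbb R\to\mathbb R$ be a roll solution, i.e. an even, $2\pi$-periodic $C^4$ function of $x$ alone that is a stationary solution of $$\partial_t u=-\big(1+(1+2\varepsilon\omega)\partial_x^2+\partial_y^2\big)^2u+\varepsilon^2u+bu^2-su^3 .$$ Let $\mathbb T=\mathbb R/2\pi\mathbb Z$ and, for $p\ge 0$, let $H^p(\mathbb T)=\{h\in L^2(\mathbb T):\ \|h\|_{H^p}^2:=\sum_{j\in\mathbb Z}(1+j^2)^p|\hat h(j)|^2<\infty\}$, where $\hat h(j)=\frac1{2\pi}\int_0^{2\pi}e^{-ijx}h(x)\,dx$ (complex-valued functions). For a Bloch wave vector $\sigma=(\sigma_1,\sigma_2)\in\mathbb R^2$ let $$B(\sigma)=-\big[1+(1+2\varepsilon\omega)(\partial_x+i\sigma_1)^2-\sigma_2^2\big]^2+\varepsilon^2+2b\tilde u-3s\tilde u^2,$$ an unbounded operator on $L^2(\mathbb T)$ with domain $H^4(\mathbb T)$. Then $B(\sigma)$ is the infinitesimal generator of a unique strongly continuous semigroup $(e^{tB(\sigma)})_{t\ge0}$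 of bounded operators on $L^2(\mathbb T)$, and for every $T>0$ the operator $e^{TB(\sigma)}$ maps $H^2(\mathbb T)$ into itself and its restriction $e^{TB(\sigma)}:H^2(\mathbb T)\to H^2(\mathbb T)$ is a (bounded) compact operator. -/

import Mathlib

open scoped NNReal ENNReal Topology

noncomputable section

namespace SwiftHohenberg

open MeasureTheory

/-! ### The circle, `L²` and the periodic Sobolev spaces -/

instance factTwoPiPos : Fact ((0 : ℝ) < 2 * Real.pi) := ⟨Real.two_pi_pos⟩

/-- The circle of length `2π`. -/
abbrev Torus : Type := AddCircle (2 * Real.pi)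

/-- The normalised Haar measure `dx / 2π` on the circle. -/
abbrev torusMeasure : Measure Torus := AddCircle.haarAddCircle

/-- The space `L²` of complex valued functions on the circle, with
`‖h‖² = (1 / 2π) ∫ |h|² = ∑ j, |ĥ j|²`. -/
abbrev L2T : Type := Lp ℂ 2 torusMeasure

/-- The Fourier coefficient `ĥ j = (1 / 2π) ∫ exp (- i j x) h x dx`. -/
def coeff (h : L2T) (j : ℤ) : ℂ := fourierCoeff (h : Torus → ℂ) j

theorem coeff_eq_repr (h : L2T) (j : ℤ) :
    coeff h j = (fourierBasis (T := 2 * Real.pi)).repr h j :=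
  (fourierBasis_repr h j).symm

theorem coeff_add (f g : L2T) (j : ℤ) : coeff (f + g) j = coeff f j + coeff g j := by
  simp [coeff_eq_repr]

theorem coeff_smul (c : ℂ) (f : L2T) (j : ℤ) : coeff (c • f) j = c * coeff f j := by
  simp [coeff_eq_repr]

theorem coeff_zero (j : ℤ) : coeff 0 j = 0 := by
  simp [coeff_eq_repr]

theorem coeff_injective {f g : L2T} (h : ∀ j, coeff f j = coeff g j) : f = g := by
  apply (fourierBasis (T := 2 * Real.pi)).repr.injective
  ext j
  simpa [coeff_eq_repr] using h j

/-- The Sobolev space of order `p`, as a subspace of `L²`: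
all `h` with `∑ j, (1 + j²) ^ p * |ĥ j|² < ∞`. -/
def sobolev (p : ℕ) : Submodule ℂ L2T where
  carrier := {h | Summable fun j : ℤ => (1 + (j : ℝ) ^ 2) ^ p * ‖coeff h j‖ ^ 2}
  zero_mem' := by simp [coeff_zero, summable_zero]
  add_mem' := by
    intro f g hf hg
    have hfg := (hf.mul_left 2).add (hg.mul_left 2)
    refine Summable.of_nonneg_of_le (fun j => by positivity) (fun j => ?_) hfg
    have h1 : ‖coeff (f + g) j‖ ^ 2 ≤ 2 * ‖coeff f j‖ ^ 2 + 2 * ‖coeff g j‖ ^ 2 := by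
      rw [coeff_add]
      have h2 := norm_add_le (coeff f j) (coeff g j)
      have h3 := norm_nonneg (coeff f j + coeff g j)
      nlinarith [sq_nonneg (‖coeff f j‖ - ‖coeff g j‖)]
    have h4 : (0 : ℝ) ≤ (1 + (j : ℝ) ^ 2) ^ p := by positivity
    have h5 := mul_le_mul_of_nonneg_left h1 h4
    linarith
  smul_mem' := by
    intro c f hf
    have h1 := hf.mul_left (‖c‖ ^ 2)
    refine h1.congr (fun j => ?_)
    rw [coeff_smul, norm_mul]
    ring

theorem mem_sobolev_iff {p : ℕ} {h : L2T} :
    h ∈ sobolev p ↔ Summable fun j : ℤ => (1 + (j : ℝ) ^ 2) ^ p * ‖coeff h j‖ ^ 2 :=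
  Iff.rfl

theorem sobolev_mono {p q : ℕ} (hpq : p ≤ q) : sobolev q ≤ sobolev p := by
  intro h hh
  refine Summable.of_nonneg_of_le (fun j => by positivity) (fun j => ?_) hh
  have h1 : (1 : ℝ) ≤ 1 + (j : ℝ) ^ 2 := by nlinarith [sq_nonneg (j : ℝ)]
  gcongr

/-- The Sobolev space of order `p` as a normed space of its own, with norm
`‖w‖² = ∑ j, (1 + j²) ^ p * |ŵ j|²` (see `HSobolev.norm_sq`), not the norm of `L²`. -/
def HSobolev (p : ℕ) : Type := sobolev p

namespace HSobolev

variable {p : ℕ}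

instance : AddCommGroup (HSobolev p) := inferInstanceAs (AddCommGroup (sobolev p))

instance : Module ℂ (HSobolev p) := inferInstanceAs (Module ℂ (sobolev p))

/-- The inclusion of the Sobolev space into `L²`. -/
def toL2 : HSobolev p →ₗ[ℂ] L2T := (sobolev p).subtype

theorem toL2_mem (w : HSobolev p) : toL2 w ∈ sobolev p := Subtype.property (p := (· ∈ sobolev p)) w

theorem toL2_injective : Function.Injective (toL2 (p := p)) := Subtype.val_injective

theorem memlp_weighted (w : HSobolev p) :
    Memℓp (fun j : ℤ => (Real.sqrt ((1 + (j : ℝ) ^ 2) ^ p) : ℂ) * coeff (toL2 w) j) 2 := by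
  rw [memℓp_gen_iff (by norm_num)]
  refine (mem_sobolev_iff.1 (toL2_mem w)).congr (fun j => ?_)
  have h0 : (0 : ℝ) ≤ (1 + (j : ℝ) ^ 2) ^ p := by positivity
  simp [mul_pow, Real.sq_sqrt h0, sq_abs]

/-- The map `w ↦ (√((1 + j²) ^ p) * ŵ j)_j` into `ℓ²`, which induces the Sobolev norm. -/
def weighted : HSobolev p →ₗ[ℂ] lp (fun _ : ℤ => ℂ) 2 where
  toFun w := ⟨fun j => (Real.sqrt ((1 + (j : ℝ) ^ 2) ^ p) : ℂ) * coeff (toL2 w) j,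
    memlp_weighted w⟩
  map_add' v w := by
    ext j
    rw [lp.coeFn_add, Pi.add_apply]
    simp [coeff_add, mul_add]
  map_smul' c w := by
    ext j
    rw [lp.coeFn_smul, Pi.smul_apply]
    simp [coeff_smul]
    ring

theorem weighted_apply (w : HSobolev p) (j : ℤ) :
    weighted w j = (Real.sqrt ((1 + (j : ℝ) ^ 2) ^ p) : ℂ) * coeff (toL2 w) j := rfl

theorem weighted_injective : Function.Injective (weighted (p := p)) := by
  intro v w h
  apply toL2_injective
  apply coeff_injective
  intro j
  have h1 : weighted v j = weighted w j := by rw [h]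
  rw [weighted_apply, weighted_apply] at h1
  have h2 : (0 : ℝ) < (1 + (j : ℝ) ^ 2) ^ p := by positivity
  have h3 : (Real.sqrt ((1 + (j : ℝ) ^ 2) ^ p) : ℂ) ≠ 0 := by
    exact_mod_cast (Real.sqrt_pos.2 h2).ne'
  exact mul_left_cancel₀ h3 h1

instance : NormedAddCommGroup (HSobolev p) :=
  NormedAddCommGroup.induced (HSobolev p) (lp (fun _ : ℤ => ℂ) 2) weighted weighted_injective

instance : NormedSpace ℂ (HSobolev p) :=
  NormedSpace.induced ℂ (HSobolev p) (lp (fun _ : ℤ => ℂ) 2) weighted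

theorem norm_sq (w : HSobolev p) :
    ‖w‖ ^ 2 = ∑' j : ℤ, (1 + (j : ℝ) ^ 2) ^ p * ‖coeff (toL2 w) j‖ ^ 2 := by
  have h1 : ‖w‖ = ‖weighted w‖ := rfl
  have h2 : ‖weighted w‖ ^ 2 = ∑' j : ℤ, ‖weighted w j‖ ^ 2 := by
    have h3 := lp.norm_rpow_eq_tsum (p := 2) (by norm_num) (weighted w)
    simpa using h3
  rw [h1, h2]
  refine tsum_congr (fun j => ?_)
  have h0 : (0 : ℝ) ≤ (1 + (j : ℝ) ^ 2) ^ p := by positivity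
  rw [weighted_apply]
  simp [mul_pow, Real.sq_sqrt h0, sq_abs]

end HSobolev

/-! ### Differentiation -/

theorem memlp_deriv {p : ℕ} (u : sobolev (p + 1)) :
    Memℓp (fun j : ℤ => Complex.I * (j : ℂ) * coeff (u : L2T) j) 2 := by
  rw [memℓp_gen_iff (by norm_num)]
  refine Summable.of_nonneg_of_le (fun j => by positivity) (fun j => ?_)
    (mem_sobolev_iff.1 (sobolev_mono (Nat.le_add_left 1 p) u.2))
  simp only [norm_mul, Complex.norm_I, one_mul, Complex.norm_intCast, ENNReal.toReal_ofNat,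
    Real.rpow_ofNat, mul_pow, sq_abs, pow_one]
  nlinarith [sq_nonneg ‖coeff (u : L2T) j‖]

/-- The (weak) derivative of `u`, the element of `L²` with Fourier coefficients `i j û j`. -/
def derivL2 {p : ℕ} (u : sobolev (p + 1)) : L2T :=
  (fourierBasis (T := 2 * Real.pi)).repr.symm
    ⟨fun j : ℤ => Complex.I * (j : ℂ) * coeff (u : L2T) j, memlp_deriv u⟩

theorem coeff_derivL2 {p : ℕ} (u : sobolev (p + 1)) (j : ℤ) :
    coeff (derivL2 u) j = Complex.I * (j : ℂ) * coeff (u : L2T) j := by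
  rw [coeff_eq_repr, derivL2, LinearIsometryEquiv.apply_symm_apply]

theorem derivL2_mem {p : ℕ} (u : sobolev (p + 1)) : derivL2 u ∈ sobolev p := by
  refine Summable.of_nonneg_of_le (fun j => by positivity) (fun j => ?_) (mem_sobolev_iff.1 u.2)
  have h1 : (0 : ℝ) ≤ (1 + (j : ℝ) ^ 2) ^ p * ‖coeff (u : L2T) j‖ ^ 2 := by positivity
  rw [coeff_derivL2]
  simp only [norm_mul, Complex.norm_I, one_mul, Complex.norm_intCast, mul_pow, sq_abs]
  have h2 : (1 + (j : ℝ) ^ 2) ^ (p + 1) * ‖coeff (u : L2T) j‖ ^ 2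
      = (1 + (j : ℝ) ^ 2) ^ p * ((j : ℝ) ^ 2 * ‖coeff (u : L2T) j‖ ^ 2)
        + (1 + (j : ℝ) ^ 2) ^ p * ‖coeff (u : L2T) j‖ ^ 2 := by ring
  linarith

/-- The derivative `∂ₓ : H^(p+1) → H^p`. -/
def dx (p : ℕ) : sobolev (p + 1) →ₗ[ℂ] sobolev p where
  toFun u := ⟨derivL2 u, derivL2_mem u⟩
  map_add' u v := by
    apply Subtype.ext
    apply coeff_injective
    intro j
    simp [coeff_derivL2, coeff_add, mul_add]
  map_smul' c u := by
    apply Subtype.ext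
    apply coeff_injective
    intro j
    simp [coeff_derivL2, coeff_smul]
    ring

/-- The inclusion `H^q → H^p` for `p ≤ q`. -/
def incl {p q : ℕ} (hpq : p ≤ q) : sobolev q →ₗ[ℂ] sobolev p :=
  Submodule.inclusion (sobolev_mono hpq)

/-- The operator `Dₓ = ∂ₓ + i σ₁ : H^(p+1) → H^p`. -/
def covDeriv (σ₁ : ℝ) (p : ℕ) : sobolev (p + 1) →ₗ[ℂ] sobolev p :=
  dx p + (Complex.I * (σ₁ : ℂ)) • incl (Nat.le_succ p)

/-! ### Roll solutions -/

/-- The operator `v ↦ v + (1 + 2 ε ω) v''` on functions of the line. -/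
def rollRoot (ε ω : ℝ) (v : ℝ → ℝ) (x : ℝ) : ℝ :=
  v x + (1 + 2 * ε * ω) * iteratedDeriv 2 v x

/-- A roll solution: a real valued, `2π`-periodic, even, classical stationary solution of
`∂ₜ u = -(1 + (1 + 2 ε ω) ∂ₓ² + ∂_y²)² u + ε² u + b u² - s u³` which depends on `x` only. -/
structure Roll (ε ω b s : ℝ) where
  toFun : ℝ → ℝ
  contDiff : ContDiff ℝ 4 toFun
  periodic : Function.Periodic toFun (2 * Real.pi)
  even : ∀ x, toFun (-x) = toFun x
  stationary : ∀ x,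
    -(rollRoot ε ω (rollRoot ε ω toFun) x)
      + ε ^ 2 * toFun x + b * toFun x ^ 2 - s * toFun x ^ 3 = 0

namespace Roll

variable {ε ω b s : ℝ}

/-- The potential `ε² + 2 b ũ - 3 s ũ²`, as a function on the line. -/
def potentialFun (u : Roll ε ω b s) (x : ℝ) : ℂ :=
  ((ε ^ 2 + 2 * b * u.toFun x - 3 * s * u.toFun x ^ 2 : ℝ) : ℂ)

theorem potentialFun_periodic (u : Roll ε ω b s) :
    Function.Periodic u.potentialFun (2 * Real.pi) := by
  intro x
  simp only [potentialFun, u.periodic x]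

theorem potentialFun_continuous (u : Roll ε ω b s) : Continuous u.potentialFun := by
  have h := u.contDiff.continuous
  unfold potentialFun
  fun_prop

/-- The potential `ε² + 2 b ũ - 3 s ũ²`, as a continuous function on the circle. -/
def potential (u : Roll ε ω b s) : C(Torus, ℂ) where
  toFun := u.potentialFun_periodic.lift
  continuous_toFun := continuous_coinduced_dom.mpr u.potentialFun_continuous

theorem potential_coe (u : Roll ε ω b s) (x : ℝ) :
    u.potential (x : Torus) = ((ε ^ 2 + 2 * b * u.toFun x - 3 * s * u.toFun x ^ 2 : ℝ) : ℂ) :=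
  rfl

end Roll

/-! ### The Bloch operator -/

/-- Multiplication by a continuous function, as a bounded operator on `L²`. -/
def mulOp (F : C(Torus, ℂ)) : L2T →L[ℂ] L2T :=
  (ContinuousLinearMap.mul ℂ ℂ).holderL torusMeasure ∞ 2 2
    (ContinuousMap.toLp ∞ torusMeasure ℂ F)

theorem coeFn_mulOp (F : C(Torus, ℂ)) (h : L2T) :
    (mulOp F h : Torus → ℂ) =ᵐ[torusMeasure] fun x => F x * h x := by
  have h1 := (ContinuousLinearMap.mul ℂ ℂ).coeFn_holder (r := 2)
    (ContinuousMap.toLp ∞ torusMeasure ℂ F) h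
  have h2 := ContinuousMap.coeFn_toLp (p := ∞) (𝕜 := ℂ) torusMeasure F
  filter_upwards [h1, h2] with x hx1 hx2
  simp only [mulOp, ContinuousLinearMap.holderL_apply_apply]
  rw [hx1, hx2, ContinuousLinearMap.mul_apply']

/-- The operator `1 + (1 + 2 ε ω) (∂ₓ + i σ₁)² - σ₂² : H^(p+2) → H^p`. -/
def blochRoot (ε ω : ℝ) (σ : ℝ × ℝ) (p : ℕ) : sobolev (p + 2) →ₗ[ℂ] sobolev p :=
  incl (Nat.le_add_right p 2)
    + ((1 + 2 * ε * ω : ℝ) : ℂ) • (covDeriv σ.1 p ∘ₗ covDeriv σ.1 (p + 1))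
    - ((σ.2 ^ 2 : ℝ) : ℂ) • incl (Nat.le_add_right p 2)

/-- The Bloch operator
`B(σ) = -[1 + (1 + 2 ε ω) (∂ₓ + i σ₁)² - σ₂²]² + ε² + 2 b ũ - 3 s ũ²`,
an unbounded operator on `L²` with domain `H⁴`. -/
def blochOperator {ε ω b s : ℝ} (u : Roll ε ω b s) (σ : ℝ × ℝ) : L2T →ₗ.[ℂ] L2T where
  domain := sobolev 4
  toFun := -((sobolev 0).subtype ∘ₗ blochRoot ε ω σ 0 ∘ₗ blochRoot ε ω σ 2)
    + (mulOp u.potential : L2T →ₗ[ℂ] L2T) ∘ₗ (sobolev 4).subtype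

/-! ### Strongly continuous semigroups -/

/-- `S` is a strongly continuous one-parameter semigroup of bounded operators on `X`. -/
structure IsC0Semigroup {X : Type*} [NormedAddCommGroup X] [NormedSpace ℂ X]
    (S : ℝ≥0 → X →L[ℂ] X) : Prop where
  map_zero : S 0 = ContinuousLinearMap.id ℂ X
  map_add : ∀ t r : ℝ≥0, S (t + r) = (S t).comp (S r)
  tendsto_zero : ∀ x : X, Filter.Tendsto (fun t : ℝ≥0 => S t x) (𝓝[>] 0) (𝓝 x)

/-- `S = (e^{tA})_{t ≥ 0}`: `S` is a strongly continuous semigroup whose infinitesimal generator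
is `A`, that is, `x` lies in the domain of `A` and `A x = y` exactly when
`(S t x - x) / t → y` as `t → 0+`. -/
structure IsSemigroupGeneratedBy {X : Type*} [NormedAddCommGroup X] [NormedSpace ℂ X]
    (S : ℝ≥0 → X →L[ℂ] X) (A : X →ₗ.[ℂ] X) : Prop where
  isC0Semigroup : IsC0Semigroup S
  generator : ∀ x y : X, (x, y) ∈ A.graph ↔
    Filter.Tendsto (fun t : ℝ≥0 => ((t : ℝ) : ℂ)⁻¹ • (S t x - x)) (𝓝[>] 0) (𝓝 y)

end SwiftHohenberg

end

/-!
Write `B = B₀ + V`, where `B₀` has the real Fourier symbol `-m²` and `V` is the bounded self-adjoint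
multiplication operator. For `μ > ‖V‖` the resolvent `(μ - B₀)⁻¹` is nonnegative of norm at most
`μ⁻¹`, so a symmetrised Neumann series turns it into a nonnegative injective resolvent
`R = (μ - B)⁻¹`. Then `e^{tB} = e^{tμ} exp (-t R⁻¹)`, the exponential being the continuous function
`x ↦ exp (-t / x)` of `R`. For `t > 0` this function is divisible by `x`, so `e^{tB}` maps `L²` into
the domain `H⁴`, boundedly by the closed graph theorem; compactness follows from that of
`H⁴ ⊆ H²`.
-/

namespace SwiftHohenberg

open Filter MeasureTheory

section UniquenessOfSemigroups

variable {X : Type*} [NormedAddCommGroup X] [NormedSpace ℂ X] {S S' : ℝ≥0 → X →L[ℂ] X}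
  {A : X →ₗ.[ℂ] X}

theorem IsC0Semigroup.map_nsmul (hS : IsC0Semigroup S) (n : ℕ) (t : ℝ≥0) :
    S (n • t) = S t ^ n := by
  induction n with
  | zero => simpa [ContinuousLinearMap.one_def] using hS.map_zero
  | succ n ih => rw [succ_nsmul, hS.map_add, ih, pow_succ]; rfl

theorem IsC0Semigroup.tendsto_nhds_zero (hS : IsC0Semigroup S) (x : X) :
    Tendsto (fun t => S t x) (𝓝 0) (𝓝 x) := by
  have hcont : ContinuousWithinAt (fun t => S t x) (Set.Ioi 0) 0 := by
    simpa [ContinuousWithinAt, hS.map_zero] using hS.tendsto_zero x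
  have hIci : Set.Ici (0 : ℝ≥0) = Set.univ := Set.Ici_bot
  rw [continuousWithinAt_Ioi_iff_Ici, hIci, continuousWithinAt_univ] at hcont
  simpa [ContinuousAt, hS.map_zero] using hcont

theorem IsC0Semigroup.exists_norm_le_near_zero [CompleteSpace X] (hS : IsC0Semigroup S) :
    ∃ M : ℝ, ∃ δ : ℝ≥0, 0 < δ ∧ ∀ t ≤ δ, ‖S t‖ ≤ M := by
  by_contra! hcon
  choose t ht hlarge using fun n : ℕ => hcon n (1 / ((n : ℝ≥0) + 1)) (by positivity)
  have ht0 : Tendsto t atTop (𝓝 0) :=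
    tendsto_of_tendsto_of_tendsto_of_le_of_le tendsto_const_nhds
      tendsto_one_div_add_atTop_nhds_zero_nat (fun _ => zero_le) ht
  obtain ⟨C, hC⟩ := banach_steinhaus (g := fun n => S (t n)) fun x => by
    obtain ⟨C, hC⟩ := ((hS.tendsto_nhds_zero x).comp ht0).norm.bddAbove_range
    exact ⟨C, fun n => hC ⟨n, rfl⟩⟩
  obtain ⟨n, hn⟩ := exists_nat_gt C
  linarith [hC n, hlarge n]

theorem IsC0Semigroup.exists_norm_le [CompleteSpace X] (hS : IsC0Semigroup S) (b : ℝ≥0) :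
    ∃ M : ℝ, ∀ t ≤ b, ‖S t‖ ≤ M := by
  obtain ⟨M, δ, hδ, hM⟩ := hS.exists_norm_le_near_zero
  obtain ⟨n, hn⟩ := exists_nat_ge (b / δ)
  refine ⟨M ^ (n + 1), fun t ht => ?_⟩
  have hstep : t / (n + 1) ≤ δ := by
    rw [div_le_iff₀ hδ] at hn
    rw [div_le_iff₀ (by positivity), mul_comm]
    exact (ht.trans hn).trans (by gcongr; exact le_self_add)
  have hpow : S t = S (t / (n + 1)) ^ (n + 1) := by
    rw [← hS.map_nsmul, nsmul_eq_mul, Nat.cast_succ, mul_div_cancel₀ _ (by positivity)]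
  rw [hpow]
  exact (norm_pow_le' _ n.succ_pos).trans (pow_le_pow_left₀ (norm_nonneg _) (hM _ hstep) _)

theorem IsC0Semigroup.tendsto_apply [CompleteSpace X] (hS : IsC0Semigroup S) {α : Type*}
    {l : Filter α} {t : α → ℝ≥0} {y : α → X} {x : X} (ht : Tendsto t l (𝓝 0))
    (hy : Tendsto y l (𝓝 x)) : Tendsto (fun i => S (t i) (y i)) l (𝓝 x) := by
  obtain ⟨M, δ, hδ, hM⟩ := hS.exists_norm_le_near_zero
  have hsmall : Tendsto (fun i => S (t i) (y i - x)) l (𝓝 0) := by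
    have hbound : Tendsto (fun i => M * ‖y i - x‖) l (𝓝 0) := by
      simpa using (hy.sub_const x).norm.const_mul M
    refine squeeze_zero_norm' ?_ hbound
    filter_upwards [ht.eventually (Iic_mem_nhds hδ)] with i hi
    exact (S (t i)).le_of_opNorm_le (hM _ hi) _
  simpa using hsmall.add ((hS.tendsto_nhds_zero x).comp ht)

theorem IsC0Semigroup.continuous_uncurry [CompleteSpace X] (hS : IsC0Semigroup S) :
    Continuous fun q : ℝ≥0 × X => S q.1 q.2 := by
  refine continuous_iff_continuousAt.2 fun ⟨a, x⟩ => ?_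
  obtain ⟨M, hM⟩ := hS.exists_norm_le a
  have hdecomp (q : ℝ≥0 × X) : S q.1 q.2 - S a x =
      S (min q.1 a) (S (q.1 - min q.1 a) q.2 - S (a - min q.1 a) x) := by
    rw [map_sub, ← ContinuousLinearMap.comp_apply, ← ContinuousLinearMap.comp_apply,
      ← hS.map_add, ← hS.map_add, add_tsub_cancel_of_le (min_le_left _ _),
      add_tsub_cancel_of_le (min_le_right _ _)]
  have hleft : Tendsto (fun q : ℝ≥0 × X => q.1 - min q.1 a) (𝓝 (a, x)) (𝓝 0) :=
    Continuous.tendsto' (by fun_prop) _ _ (by simp)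
  have hright : Tendsto (fun q : ℝ≥0 × X => a - min q.1 a) (𝓝 (a, x)) (𝓝 0) :=
    Continuous.tendsto' (by fun_prop) _ _ (by simp)
  have hbound := ((hS.tendsto_apply hleft (continuous_snd.tendsto (a, x))).sub
    (hS.tendsto_apply hright (tendsto_const_nhds (x := x)))).norm.const_mul M
  rw [sub_self, norm_zero, mul_zero] at hbound
  refine tendsto_sub_nhds_zero_iff.1 (squeeze_zero_norm (fun q => ?_) hbound)
  rw [hdecomp]
  exact (S _).le_of_opNorm_le (hM _ (min_le_right _ _)) _

theorem IsSemigroupGeneratedBy.orbit_mem_graph (hS : IsSemigroupGeneratedBy S A) {x y : X}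
    (hxy : (x, y) ∈ A.graph) (t : ℝ≥0) : (S t x, S t y) ∈ A.graph := by
  rw [hS.generator]
  refine (((S t).continuous.tendsto y).comp ((hS.generator x y).1 hxy)).congr fun r => ?_
  have hcomm : S t (S r x) = S r (S t x) := by
    rw [← ContinuousLinearMap.comp_apply, ← ContinuousLinearMap.comp_apply,
      ← hS.isC0Semigroup.map_add, ← hS.isC0Semigroup.map_add, add_comm]
  simp [hcomm]

/-- `S (t - r) (S' r x)` is an interpolation between `S t x` and `S' t x`; its right derivative
vanishes because both semigroups have the same generator. -/
theorem IsSemigroupGeneratedBy.hasDerivWithinAt_interpolation [CompleteSpace X]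
    (hS : IsSemigroupGeneratedBy S A) (hS' : IsSemigroupGeneratedBy S' A) {x y : X}
    (hxy : (x, y) ∈ A.graph) {t : ℝ≥0} {r : ℝ} (hr : r ∈ Set.Ico 0 (t : ℝ)) :
    HasDerivWithinAt (fun r : ℝ => S (t - r.toNNReal) (S' r.toNNReal x)) 0 (Set.Ici r) r := by
  obtain ⟨M, hM⟩ := hS.isC0Semigroup.exists_norm_le t
  set z := S' r.toNNReal x
  have hquot : Tendsto (fun h : ℝ≥0 => ((h : ℝ) : ℂ)⁻¹ • (S' h z - S h z)) (𝓝[>] 0) (𝓝 0) := by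
    have hgraph := hS'.orbit_mem_graph hxy r.toNNReal
    have hsub := ((hS'.generator _ _).1 hgraph).sub ((hS.generator _ _).1 hgraph)
    simpa [← smul_sub] using hsub
  have hstep : Tendsto (fun r' : ℝ => (r' - r).toNNReal) (𝓝[>] r) (𝓝[>] 0) := by
    refine tendsto_nhdsWithin_iff.2 ⟨?_, ?_⟩
    · exact (Continuous.tendsto' (by fun_prop) _ _ (by simp)).mono_left nhdsWithin_le_nhds
    · filter_upwards [self_mem_nhdsWithin] with r' hr'
      simpa using hr'
  have hbound := (hquot.comp hstep).norm.const_mul M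
  rw [norm_zero, mul_zero] at hbound
  rw [← hasDerivWithinAt_Ioi_iff_Ici, hasDerivWithinAt_iff_tendsto_slope' Set.self_notMem_Ioi]
  refine squeeze_zero_norm' ?_ hbound
  filter_upwards [Ioc_mem_nhdsGT hr.2] with r' hr'
  set h := (r' - r).toNNReal with hh
  have hadd : r'.toNNReal = h + r.toNNReal := by
    rw [hh, ← Real.toNNReal_add (sub_nonneg.2 hr'.1.le) hr.1, sub_add_cancel]
  have hle : h + r.toNNReal ≤ t := by
    simpa [hadd] using Real.toNNReal_mono hr'.2
  have hsplit : t - r.toNNReal = (t - (h + r.toNNReal)) + h := by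
    rw [add_comm h, ← tsub_tsub, tsub_add_cancel_of_le (le_tsub_of_add_le_right hle)]
  have hslope : slope (fun r : ℝ => S (t - r.toNNReal) (S' r.toNNReal x)) r r' =
      S (t - (h + r.toNNReal)) (((h : ℝ) : ℂ)⁻¹ • (S' h z - S h z)) := by
    rw [slope_def_module, hadd, hS'.isC0Semigroup.map_add, hsplit, hS.isC0Semigroup.map_add,
      ← Complex.coe_smul, Complex.ofReal_inv, map_smul, map_sub, hh,
      Real.coe_toNNReal _ (sub_nonneg.2 hr'.1.le)]
    rfl
  rw [hslope]
  exact (S _).le_of_opNorm_le (hM _ tsub_le_self) _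

theorem IsSemigroupGeneratedBy.unique [CompleteSpace X] (hS : IsSemigroupGeneratedBy S A)
    (hS' : IsSemigroupGeneratedBy S' A) (hA : Dense (A.domain : Set X)) : S = S' := by
  funext t
  refine DFunLike.coe_injective (Continuous.ext_on hA (S t).continuous (S' t).continuous ?_)
  intro x hx
  have hcont : Continuous fun r : ℝ => S (t - r.toNNReal) (S' r.toNNReal x) :=
    hS.isC0Semigroup.continuous_uncurry.comp ((by fun_prop : Continuous fun r : ℝ =>
      t - r.toNNReal).prodMk (hS'.isC0Semigroup.continuous_uncurry.comp
        (continuous_real_toNNReal.prodMk continuous_const)))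
  have hconst := constant_of_has_deriv_right_zero hcont.continuousOn
    (fun r => hS.hasDerivWithinAt_interpolation hS' (A.mem_graph ⟨x, hx⟩)) t ⟨t.2, le_rfl⟩
  simpa [hS.isC0Semigroup.map_zero, hS'.isC0Semigroup.map_zero] using hconst.symm

end UniquenessOfSemigroups

section Rescaling

variable {X : Type*} [NormedAddCommGroup X] [NormedSpace ℂ X] {S : ℝ≥0 → X →L[ℂ] X}

theorem IsC0Semigroup.exp_smul (hS : IsC0Semigroup S) (μ : ℂ) :
    IsC0Semigroup fun t => Complex.exp (t * μ) • S t where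
  map_zero := by simp [hS.map_zero]
  map_add t r := by
    ext x
    simp [hS.map_add, add_mul, Complex.exp_add, smul_smul, mul_comm (Complex.exp (r * μ))]
  tendsto_zero x := by
    have hexp : Tendsto (fun t : ℝ≥0 => Complex.exp (t * μ)) (𝓝[>] 0) (𝓝 1) :=
      (Continuous.tendsto' (by fun_prop) _ _ (by simp)).mono_left nhdsWithin_le_nhds
    simpa using hexp.smul (hS.tendsto_zero x)

theorem IsC0Semigroup.tendsto_differenceQuotient_exp_smul_iff (hS : IsC0Semigroup S) (μ : ℂ)
    {x y : X} :
    Tendsto (fun t : ℝ≥0 => ((t : ℝ) : ℂ)⁻¹ • ((Complex.exp (t * μ) • S t) x - x))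
        (𝓝[>] 0) (𝓝 y) ↔
      Tendsto (fun t : ℝ≥0 => ((t : ℝ) : ℂ)⁻¹ • (S t x - x)) (𝓝[>] 0) (𝓝 (y - μ • x)) := by
  have hderiv : Tendsto (fun t : ℝ≥0 => ((t : ℝ) : ℂ)⁻¹ * (Complex.exp (t * μ) - 1))
      (𝓝[>] 0) (𝓝 μ) := by
    have hexp : HasDerivAt (fun z : ℂ => Complex.exp (z * μ)) μ 0 := by
      simpa using ((hasDerivAt_id (0 : ℂ)).mul_const μ).cexp
    have hcoe : Tendsto (fun t : ℝ≥0 => ((t : ℝ) : ℂ)) (𝓝[>] 0) (𝓝[≠] 0) := by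
      refine tendsto_nhdsWithin_iff.2 ⟨?_, ?_⟩
      · exact (Continuous.tendsto' (by fun_prop) _ _ (by simp)).mono_left nhdsWithin_le_nhds
      · filter_upwards [self_mem_nhdsWithin] with t ht
        simpa using (Set.mem_Ioi.1 ht).ne'
    simpa [Function.comp_def] using hexp.tendsto_slope_zero.comp hcoe
  have hcorr := hderiv.smul (hS.tendsto_zero x)
  have hsplit (t : ℝ≥0) : ((t : ℝ) : ℂ)⁻¹ • ((Complex.exp (t * μ) • S t) x - x) =
      ((t : ℝ) : ℂ)⁻¹ • (S t x - x) +
        (((t : ℝ) : ℂ)⁻¹ * (Complex.exp (t * μ) - 1)) • S t x := by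
    rw [mul_smul, ← smul_add, sub_smul, one_smul, smul_apply]
    congr 1
    abel
  simp only [hsplit]
  refine ⟨fun h => ?_, fun h => ?_⟩
  · simpa using h.sub hcorr
  · simpa using h.add hcorr

end Rescaling

theorem range_subset_domain_of_mem_graph_iff {X : Type*} [AddCommGroup X] [Module ℂ X]
    {A : X →ₗ.[ℂ] X} {R : X → X} {μ : ℂ} (hA : ∀ x y, (x, y) ∈ A.graph ↔ R (μ • x - y) = x) :
    Set.range R ⊆ A.domain := by
  rintro _ ⟨z, rfl⟩
  exact LinearPMap.mem_domain_of_mem_graph ((hA (R z) (μ • R z - z)).2 (by rw [sub_sub_cancel]))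

theorem tendsto_of_denseRange {𝕜 X Y α ι : Type*} [NontriviallyNormedField 𝕜]
    [SeminormedAddCommGroup X] [NormedSpace 𝕜 X] [SeminormedAddCommGroup Y] [NormedSpace 𝕜 Y]
    {l : Filter ι} {G : ι → X →L[𝕜] Y} {L : X →L[𝕜] Y} {C : ℝ} (hG : ∀ i, ‖G i‖ ≤ C)
    {f : α → X} (hf : DenseRange f) (h : ∀ a, Tendsto (fun i => G i (f a)) l (𝓝 (L (f a))))
    (x : X) : Tendsto (fun i => G i x) l (𝓝 (L x)) := by
  have hequi : Equicontinuous ((↑) ∘ G) :=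
    (show Equicontinuous ((↑) ∘ G) ↔ ∃ C, ∀ i, ‖G i‖ ≤ C from
      (NormedSpace.equicontinuous_TFAE G).out 1 5).2 ⟨C, hG⟩
  exact hf.induction_on x (hequi.isClosed_setOfPred_tendsto L.continuous) h

theorem denseRange_of_isSelfAdjoint_of_injective {𝕜 H : Type*} [RCLike 𝕜] [NormedAddCommGroup H]
    [InnerProductSpace 𝕜 H] [CompleteSpace H] {R : H →L[𝕜] H} (hR : IsSelfAdjoint R)
    (hinj : Function.Injective R) : DenseRange R := by
  have hperp : R.rangeᗮ = ⊥ := by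
    rw [ContinuousLinearMap.orthogonal_range, ← ContinuousLinearMap.star_eq_adjoint, hR.star_eq]
    exact LinearMap.ker_eq_bot.2 hinj
  exact Submodule.dense_iff_topologicalClosure_eq_top.2
    (Submodule.topologicalClosure_eq_top_iff.2 hperp)

section ExpNegInv

@[fun_prop]
theorem continuous_expNegInvGlue : Continuous expNegInvGlue :=
  (expNegInvGlue.contDiff (n := 0)).continuous

theorem expNegInvGlue_le_one (x : ℝ) : expNegInvGlue x ≤ 1 := by
  rcases le_or_gt x 0 with hx | hx
  · simp [expNegInvGlue.zero_of_nonpos hx]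
  · rw [expNegInvGlue, if_neg hx.not_ge]
    exact Real.exp_le_one_iff.2 (neg_nonpos.2 (inv_nonneg.2 hx.le))

theorem expNegInvGlue_div_eq_exp {t x : ℝ} (ht : 0 < t) (hx : 0 < x) :
    expNegInvGlue (x / t) = Real.exp (-(t / x)) := by
  rw [expNegInvGlue, if_neg (div_pos hx ht).not_ge, inv_div]

theorem exp_neg_sub_one_add_le_sq {s : ℝ} (hs : 0 ≤ s) : Real.exp (-s) - 1 + s ≤ s ^ 2 := by
  have hexp : Real.exp (-s) ≤ (1 + s)⁻¹ := by
    rw [Real.exp_neg]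
    exact inv_anti₀ (by positivity) (by linarith [Real.add_one_le_exp s])
  have hinv : (1 + s)⁻¹ - 1 + s ≤ s ^ 2 := by
    rw [← sub_nonneg]
    have heq : s ^ 2 - ((1 + s)⁻¹ - 1 + s) = s ^ 3 / (1 + s) := by field_simp; ring
    rw [heq]
    positivity
  linarith

theorem abs_inv_mul_expNegInvGlue_sub_one_mul_le {t x : ℝ} (ht : 0 < t) (hx : 0 ≤ x) :
    |t⁻¹ * ((expNegInvGlue (x / t) - 1) * x)| ≤ 1 := by
  rcases hx.eq_or_lt with rfl | hx
  · simp
  have hs : 0 < t / x := by positivity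
  have heq : t⁻¹ * ((expNegInvGlue (x / t) - 1) * x) = (Real.exp (-(t / x)) - 1) / (t / x) := by
    rw [expNegInvGlue_div_eq_exp ht hx]
    field_simp
  rw [heq, abs_div, abs_of_pos hs, div_le_one hs, abs_le]
  have hle : Real.exp (-(t / x)) ≤ 1 := Real.exp_le_one_iff.2 (by linarith)
  constructor <;> linarith [Real.one_sub_le_exp_neg (t / x)]

theorem abs_inv_mul_expNegInvGlue_sub_one_mul_add_one_mul_le {t x : ℝ} (ht : 0 < t)
    (hx : 0 ≤ x) : |(t⁻¹ * ((expNegInvGlue (x / t) - 1) * x) + 1) * x| ≤ t := by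
  rcases hx.eq_or_lt with rfl | hx
  · simpa using ht.le
  set s := t / x with hs
  have hs0 : 0 < s := by positivity
  have heq : (t⁻¹ * ((expNegInvGlue (x / t) - 1) * x) + 1) * x =
      (Real.exp (-s) - 1 + s) * (t / s ^ 2) := by
    rw [expNegInvGlue_div_eq_exp ht hx, ← hs, hs]
    field_simp
  have hnonneg : 0 ≤ Real.exp (-s) - 1 + s := by linarith [Real.one_sub_le_exp_neg s]
  rw [heq, abs_of_nonneg (by positivity)]
  calc (Real.exp (-s) - 1 + s) * (t / s ^ 2) ≤ s ^ 2 * (t / s ^ 2) := by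
        gcongr
        exact exp_neg_sub_one_add_le_sq hs0.le
    _ = t := by field_simp

variable {H : Type*} [NormedAddCommGroup H] [InnerProductSpace ℂ H] [CompleteSpace H]
  {R : H →L[ℂ] H}

/-- The operator `exp (-t R⁻¹)` for a nonnegative injective bounded operator `R`, through the
function `x ↦ exp (-t / x)`, continued by `0` to the (possible) spectral value `x = 0`. -/
noncomputable def expNegInv (R : H →L[ℂ] H) (t : ℝ≥0) : H →L[ℂ] H :=
  if t = 0 then 1 else cfc (fun x : ℝ => expNegInvGlue (x / t)) R

theorem expNegInv_zero : expNegInv R 0 = 1 := if_pos rfl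

theorem expNegInv_of_pos {t : ℝ≥0} (ht : 0 < t) :
    expNegInv R t = cfc (fun x : ℝ => expNegInvGlue (x / t)) R := if_neg ht.ne'

theorem norm_expNegInv_le_one (t : ℝ≥0) : ‖expNegInv R t‖ ≤ 1 := by
  rcases eq_zero_or_pos t with rfl | ht
  · exact expNegInv_zero (R := R) ▸ ContinuousLinearMap.norm_id_le
  · rw [expNegInv_of_pos ht]
    refine norm_cfc_le zero_le_one fun x _ => ?_
    rw [Real.norm_of_nonneg (expNegInvGlue.nonneg _)]
    exact expNegInvGlue_le_one _

theorem commute_expNegInv (t : ℝ≥0) : Commute (expNegInv R t) R := by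
  rcases eq_zero_or_pos t with rfl | ht
  · simp [expNegInv_zero]
  · exact expNegInv_of_pos (R := R) ht ▸ (Commute.refl R).cfc_real _

theorem expNegInv_add (hR : 0 ≤ R) (t r : ℝ≥0) :
    expNegInv R (t + r) = expNegInv R t * expNegInv R r := by
  rcases eq_zero_or_pos t with rfl | ht
  · simp [expNegInv_zero]
  rcases eq_zero_or_pos r with rfl | hr
  · simp [expNegInv_zero]
  rw [expNegInv_of_pos ht, expNegInv_of_pos hr, expNegInv_of_pos (by positivity),
    ← cfc_mul _ _ R (by fun_prop) (by fun_prop)]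
  refine cfc_congr fun x hx => ?_
  rcases (spectrum_nonneg_of_nonneg hR hx).eq_or_lt with rfl | hx
  · simp
  rw [← NNReal.coe_pos] at ht hr
  rw [NNReal.coe_add, expNegInvGlue_div_eq_exp ht hx, expNegInvGlue_div_eq_exp hr hx,
    expNegInvGlue_div_eq_exp (by positivity) hx, ← Real.exp_add]
  ring_nf

theorem range_expNegInv_subset (hR : 0 ≤ R) {t : ℝ≥0} (ht : 0 < t) :
    Set.range (expNegInv R t) ⊆ Set.range R := by
  rw [← NNReal.coe_pos] at ht
  have hcont : Continuous fun x : ℝ => (t : ℝ)⁻¹ * ((x / t)⁻¹ * expNegInvGlue (x / t)) := by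
    have h := expNegInvGlue.continuous_polynomial_eval_inv_mul Polynomial.X
    simp only [Polynomial.eval_X] at h
    exact continuous_const.mul (h.comp (continuous_id.div_const (t : ℝ)))
  have hfactor : expNegInv R t =
      R * cfc (fun x : ℝ => (t : ℝ)⁻¹ * ((x / t)⁻¹ * expNegInvGlue (x / t))) R := by
    nth_rewrite 2 [← cfc_id' ℝ R (IsSelfAdjoint.of_nonneg hR)]
    rw [expNegInv_of_pos ht, ← cfc_mul _ _ R (by fun_prop) hcont.continuousOn]
    refine cfc_congr fun x hx => ?_
    rcases (spectrum_nonneg_of_nonneg hR hx).eq_or_lt with rfl | hx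
    · simp
    · field_simp
  rintro _ ⟨x, rfl⟩
  rw [hfactor]
  exact ⟨_, rfl⟩

theorem inv_smul_expNegInv_sub_one_mul_eq_cfc (hR : IsSelfAdjoint R) {t : ℝ≥0} (ht : 0 < t) :
    (t : ℝ)⁻¹ • ((expNegInv R t - 1) * R) =
      cfc (fun x : ℝ => (t : ℝ)⁻¹ * ((expNegInvGlue (x / t) - 1) * x)) R := by
  rw [cfc_const_mul _ (fun x : ℝ => (expNegInvGlue (x / t) - 1) * x) R (by fun_prop),
    cfc_mul (fun x : ℝ => expNegInvGlue (x / t) - 1) (fun x : ℝ => x) R (by fun_prop)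
      (by fun_prop),
    cfc_sub (fun x : ℝ => expNegInvGlue (x / t)) (fun _ : ℝ => (1 : ℝ)) R (by fun_prop)
      (by fun_prop),
    cfc_id' ℝ R hR, cfc_const_one ℝ R hR, expNegInv_of_pos ht]

theorem norm_inv_smul_expNegInv_sub_one_mul_le (hR : 0 ≤ R) (t : ℝ≥0) :
    ‖(t : ℝ)⁻¹ • ((expNegInv R t - 1) * R)‖ ≤ 1 := by
  rcases eq_zero_or_pos t with rfl | ht
  · simp
  rw [inv_smul_expNegInv_sub_one_mul_eq_cfc (IsSelfAdjoint.of_nonneg hR) ht]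
  exact norm_cfc_le zero_le_one fun x hx =>
    abs_inv_mul_expNegInvGlue_sub_one_mul_le ht (spectrum_nonneg_of_nonneg hR hx)

theorem norm_inv_smul_expNegInv_sub_one_mul_add_one_mul_le (hR : 0 ≤ R) {t : ℝ≥0} (ht : 0 < t) :
    ‖((t : ℝ)⁻¹ • ((expNegInv R t - 1) * R) + 1) * R‖ ≤ t := by
  have hsa := IsSelfAdjoint.of_nonneg hR
  have heq : ((t : ℝ)⁻¹ • ((expNegInv R t - 1) * R) + 1) * R =
      cfc (fun x : ℝ => ((t : ℝ)⁻¹ * ((expNegInvGlue (x / t) - 1) * x) + 1) * x) R := by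
    rw [cfc_mul (fun x : ℝ => (t : ℝ)⁻¹ * ((expNegInvGlue (x / t) - 1) * x) + 1)
        (fun x : ℝ => x) R (by fun_prop) (by fun_prop),
      cfc_add R (fun x : ℝ => (t : ℝ)⁻¹ * ((expNegInvGlue (x / t) - 1) * x))
        (fun _ : ℝ => (1 : ℝ)) (by fun_prop) (by fun_prop),
      cfc_id' ℝ R hsa, cfc_const_one ℝ R hsa, inv_smul_expNegInv_sub_one_mul_eq_cfc hsa ht]
  rw [heq]
  exact norm_cfc_le t.2 fun x hx =>
    abs_inv_mul_expNegInvGlue_sub_one_mul_add_one_mul_le ht (spectrum_nonneg_of_nonneg hR hx)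

theorem tendsto_coe_nhdsGT_zero : Tendsto (fun t : ℝ≥0 => (t : ℝ)) (𝓝[>] 0) (𝓝 0) :=
  (NNReal.continuous_coe.tendsto' 0 0 NNReal.coe_zero).mono_left nhdsWithin_le_nhds

theorem tendsto_differenceQuotient_expNegInv (hR : 0 ≤ R) (hinj : Function.Injective R) (z : H) :
    Tendsto (fun t : ℝ≥0 => ((t : ℝ) : ℂ)⁻¹ • (expNegInv R t (R z) - R z)) (𝓝[>] 0)
      (𝓝 (-z)) := by
  have hlim := tendsto_of_denseRange (l := 𝓝[>] (0 : ℝ≥0)) (L := -1)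
    (norm_inv_smul_expNegInv_sub_one_mul_le hR)
    (denseRange_of_isSelfAdjoint_of_injective (IsSelfAdjoint.of_nonneg hR) hinj) (fun v => ?_) z
  · refine hlim.congr fun t => ?_
    simp [← Complex.ofReal_inv, Complex.coe_smul]
  · have hbound : Tendsto (fun t : ℝ≥0 => (t : ℝ) * ‖v‖) (𝓝[>] 0) (𝓝 0) := by
      simpa using tendsto_coe_nhdsGT_zero.mul_const ‖v‖
    refine tendsto_sub_nhds_zero_iff.1 (squeeze_zero_norm' ?_ hbound)
    filter_upwards [self_mem_nhdsWithin] with t ht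
    simpa using ContinuousLinearMap.le_of_opNorm_le _
      (norm_inv_smul_expNegInv_sub_one_mul_add_one_mul_le hR ht) v

theorem isC0Semigroup_expNegInv (hR : 0 ≤ R) (hinj : Function.Injective R) :
    IsC0Semigroup (expNegInv R) where
  map_zero := expNegInv_zero
  map_add := expNegInv_add hR
  tendsto_zero := by
    refine tendsto_of_denseRange (L := ContinuousLinearMap.id ℂ H) norm_expNegInv_le_one
      (denseRange_of_isSelfAdjoint_of_injective (IsSelfAdjoint.of_nonneg hR) hinj) fun z => ?_
    have hlim := ((Complex.continuous_ofReal.tendsto' 0 0 rfl).comp tendsto_coe_nhdsGT_zero).smul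
      (tendsto_differenceQuotient_expNegInv hR hinj z)
    rw [zero_smul] at hlim
    refine tendsto_sub_nhds_zero_iff.1 (hlim.congr' ?_)
    filter_upwards [self_mem_nhdsWithin] with t ht
    have ht' : ((t : ℝ) : ℂ) ≠ 0 := by simpa using (Set.mem_Ioi.1 ht).ne'
    simp [smul_smul, mul_inv_cancel₀ ht']

theorem tendsto_differenceQuotient_expNegInv_iff (hR : 0 ≤ R) (hinj : Function.Injective R)
    {x y : H} :
    Tendsto (fun t : ℝ≥0 => ((t : ℝ) : ℂ)⁻¹ • (expNegInv R t x - x)) (𝓝[>] 0) (𝓝 y) ↔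
      R (-y) = x := by
  refine ⟨fun h => ?_, fun h => ?_⟩
  · have hcomm (t : ℝ≥0) : R (expNegInv R t x) = expNegInv R t (R x) :=
      (DFunLike.congr_fun (commute_expNegInv t).eq x).symm
    have hlim : Tendsto (fun t : ℝ≥0 => ((t : ℝ) : ℂ)⁻¹ • (expNegInv R t (R x) - R x))
        (𝓝[>] 0) (𝓝 (R y)) :=
      ((R.continuous.tendsto y).comp h).congr fun t => by simp [hcomm]
    rw [map_neg, tendsto_nhds_unique hlim (tendsto_differenceQuotient_expNegInv hR hinj x),
      neg_neg]
  · simpa [h] using tendsto_differenceQuotient_expNegInv hR hinj (-y)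

theorem isSemigroupGeneratedBy_exp_smul_expNegInv (hR : 0 ≤ R) (hinj : Function.Injective R)
    {μ : ℂ} {A : H →ₗ.[ℂ] H} (hA : ∀ x y, (x, y) ∈ A.graph ↔ R (μ • x - y) = x) :
    IsSemigroupGeneratedBy (fun t => Complex.exp (t * μ) • expNegInv R t) A where
  isC0Semigroup := (isC0Semigroup_expNegInv hR hinj).exp_smul μ
  generator x y := by
    rw [(isC0Semigroup_expNegInv hR hinj).tendsto_differenceQuotient_exp_smul_iff,
      tendsto_differenceQuotient_expNegInv_iff hR hinj, neg_sub, hA]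

theorem IsSemigroupGeneratedBy.eq_exp_smul_expNegInv (hR : 0 ≤ R) (hinj : Function.Injective R)
    {μ : ℂ} {A : H →ₗ.[ℂ] H} (hA : ∀ x y, (x, y) ∈ A.graph ↔ R (μ • x - y) = x)
    {S : ℝ≥0 → H →L[ℂ] H} (hS : IsSemigroupGeneratedBy S A) :
    S = fun t : ℝ≥0 => Complex.exp (t * μ) • expNegInv R t :=
  hS.unique (isSemigroupGeneratedBy_exp_smul_expNegInv hR hinj hA)
    ((denseRange_of_isSelfAdjoint_of_injective (IsSelfAdjoint.of_nonneg hR) hinj).mono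
      (range_subset_domain_of_mem_graph_iff hA))

theorem existsUnique_isSemigroupGeneratedBy (hR : 0 ≤ R) (hinj : Function.Injective R) {μ : ℂ}
    {A : H →ₗ.[ℂ] H} (hA : ∀ x y, (x, y) ∈ A.graph ↔ R (μ • x - y) = x) :
    ∃! S, IsSemigroupGeneratedBy S A :=
  ⟨_, isSemigroupGeneratedBy_exp_smul_expNegInv hR hinj hA,
    fun _ hS => hS.eq_exp_smul_expNegInv hR hinj hA⟩

theorem IsSemigroupGeneratedBy.apply_mem_domain (hR : 0 ≤ R) (hinj : Function.Injective R)
    {μ : ℂ} {A : H →ₗ.[ℂ] H} (hA : ∀ x y, (x, y) ∈ A.graph ↔ R (μ • x - y) = x)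
    {S : ℝ≥0 → H →L[ℂ] H} (hS : IsSemigroupGeneratedBy S A) {t : ℝ≥0} (ht : 0 < t) (x : H) :
    S t x ∈ A.domain := by
  rw [hS.eq_exp_smul_expNegInv hR hinj hA]
  exact A.domain.smul_mem _
    (range_subset_domain_of_mem_graph_iff hA (range_expNegInv_subset hR ht ⟨x, rfl⟩))

end ExpNegInv

section PerturbedResolvent

theorem exists_nonneg_eq_add_mul_mul {A : Type*} [CStarAlgebra A] [PartialOrder A]
    [StarOrderedRing A] {a v : A} (ha : 0 ≤ a) (hv : IsSelfAdjoint v) (hva : ‖v‖ * ‖a‖ < 1) :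
    ∃ r : A, 0 ≤ r ∧ r = a + r * v * a ∧ r = a + a * v * r := by
  obtain ⟨q, hq, hqq⟩ : ∃ q : A, 0 ≤ q ∧ q * q = a :=
    ⟨CFC.sqrt a, CFC.sqrt_nonneg a, CFC.sqrt_mul_sqrt_self a⟩
  have hqsa : IsSelfAdjoint q := .of_nonneg hq
  have hnorm : ‖q * v * q‖ < 1 := by
    refine lt_of_le_of_lt ?_ hva
    calc ‖q * v * q‖ ≤ ‖q‖ * ‖v‖ * ‖q‖ := (norm_mul_le _ _).trans (by gcongr; exact norm_mul_le _ _)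
      _ = ‖v‖ * (‖q‖ * ‖q‖) := by ring
      _ = ‖v‖ * ‖a‖ := by rw [← hqq, hqsa.norm_mul_self]; ring
  set u : Aˣ := Units.oneSub (q * v * q) hnorm
  have hu : (u : A) = 1 - q * v * q := rfl
  have hu0 : 0 ≤ (u : A) := by
    have hle : q * v * q ≤ algebraMap ℝ A ‖q * v * q‖ :=
      (hv.conjugate_self hqsa).le_algebraMap_norm_self
    exact sub_nonneg.2 (hle.trans ((algebraMap_mono A hnorm.le).trans_eq (map_one _)))
  refine ⟨q * (↑u⁻¹ : A) * q, hqsa.conjugate_nonneg (CFC.inv_nonneg_of_nonneg u hu0), ?_, ?_⟩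
  · have hinv : (↑u⁻¹ : A) = 1 + (↑u⁻¹ : A) * (q * v * q) := by
      rw [← sub_eq_iff_eq_add, ← mul_one_sub, ← hu, u.inv_mul]
    nth_rewrite 1 [hinv]
    rw [← hqq]
    noncomm_ring
  · have hinv : (↑u⁻¹ : A) = 1 + q * v * q * (↑u⁻¹ : A) := by
      rw [← sub_eq_iff_eq_add, ← one_sub_mul, ← hu, u.mul_inv]
    nth_rewrite 1 [hinv]
    rw [← hqq]
    noncomm_ring

theorem apply_eq_iff_of_eq_add_mul_mul {𝕜 X : Type*} [Ring 𝕜] [TopologicalSpace X]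
    [AddCommGroup X] [IsTopologicalAddGroup X] [Module 𝕜 X] {R R₀ V : X →L[𝕜] X}
    (hl : R = R₀ + R * V * R₀) (hr : R = R₀ + R₀ * V * R) {x y : X} :
    R y = x ↔ R₀ (y + V x) = x := by
  constructor
  · rintro rfl
    simpa using (DFunLike.congr_fun hr y).symm
  · intro h
    have hl' : R (y + V x) = x + R (V x) := by simpa [h] using DFunLike.congr_fun hl (y + V x)
    simpa using hl'

end PerturbedResolvent

section DiagonalOperator

variable {ι 𝕜 : Type*} [RCLike 𝕜]

/-- The diagonal operator on `ℓ²` with bounded entries `m i`. -/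
noncomputable def diagonalOperator (m : lp (fun _ : ι => 𝕜) ∞) :
    lp (fun _ : ι => 𝕜) 2 →L[𝕜] lp (fun _ : ι => 𝕜) 2 :=
  lp.holderL 2 (fun _ => ContinuousLinearMap.mul 𝕜 𝕜) (K := 1) (fun _ => by simp) m

theorem diagonalOperator_apply (m : lp (fun _ : ι => 𝕜) ∞) (f : lp (fun _ : ι => 𝕜) 2) (i : ι) :
    diagonalOperator m f i = m i * f i := rfl

theorem norm_diagonalOperator_le (m : lp (fun _ : ι => 𝕜) ∞) : ‖diagonalOperator m‖ ≤ ‖m‖ :=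
  (ContinuousLinearMap.le_of_opNorm_le _ (lp.norm_holderL_le _ _ _) m).trans_eq (one_mul _)

open scoped ComplexOrder in
theorem diagonalOperator_nonneg {m : lp (fun _ : ι => ℂ) ∞} (hm : ∀ i, 0 ≤ (m i : ℂ)) :
    0 ≤ diagonalOperator m := by
  rw [ContinuousLinearMap.nonneg_iff_isPositive, ContinuousLinearMap.isPositive_iff_complex]
  intro f
  have hinner : 0 ≤ inner ℂ (diagonalOperator m f) f := by
    refine (lp.hasSum_inner (diagonalOperator m f) f).nonneg fun i => ?_
    rw [diagonalOperator_apply, RCLike.inner_apply, map_mul, mul_left_comm, RCLike.mul_conj]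
    exact mul_nonneg (star_nonneg_iff.2 (hm i)) (by positivity)
  exact ⟨(Complex.eq_re_of_ofReal_le hinner).symm, (Complex.nonneg_iff.1 hinner).1⟩

theorem hasSum_single_of_tendsto_cofinite [DecidableEq ι] {m : lp (fun _ : ι => 𝕜) ∞}
    (hm : Tendsto m cofinite (𝓝 0)) : HasSum (fun i => lp.single ∞ i (m i)) m := by
  refine Metric.tendsto_nhds.2 fun δ hδ => ?_
  have hfin : {i | ¬ ‖m i‖ < δ / 2}.Finite :=
    (tendsto_zero_iff_norm_tendsto_zero.1 hm).eventually_lt_const (half_pos hδ)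
  filter_upwards [eventually_ge_atTop hfin.toFinset] with s hs
  rw [dist_comm, dist_eq_norm]
  refine lt_of_le_of_lt (lp.norm_le_of_forall_le (half_pos hδ).le fun i => ?_) (half_lt_self hδ)
  rw [lp.coeFn_sub, Pi.sub_apply, lp.coeFn_sum, Finset.sum_apply]
  simp only [lp.coeFn_single, Finset.sum_pi_single]
  split_ifs with hi
  · simpa using (half_pos hδ).le
  · have hlt : ‖m i‖ < δ / 2 := by
      by_contra hge
      exact hi (hs (hfin.mem_toFinset.2 hge))
    simpa using hlt.le

theorem isCompactOperator_diagonalOperator_single [DecidableEq ι] (i : ι) (c : 𝕜) :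
    IsCompactOperator (diagonalOperator (lp.single ∞ i c)) := by
  have heq : diagonalOperator (lp.single ∞ i c) =
      ContinuousLinearMap.toSpanSingleton 𝕜 (lp.single 2 i c) ∘L
        lp.evalCLM 𝕜 (fun _ : ι => 𝕜) 2 i := by
    ext f j
    rcases eq_or_ne j i with rfl | hij
    · simp only [diagonalOperator_apply, lp.single_apply_self, ContinuousLinearMap.comp_apply,
        ContinuousLinearMap.toSpanSingleton_apply, lp.coeFn_smul, Pi.smul_apply, smul_eq_mul]
      exact mul_comm c (f j)
    · simp [diagonalOperator_apply, hij]
  rw [heq]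
  exact (isCompactOperator_of_locallyCompactSpace_dom
    (lp.evalCLM 𝕜 (fun _ : ι => 𝕜) 2 i)).clm_comp
      (ContinuousLinearMap.toSpanSingleton 𝕜 (lp.single 2 i c : lp (fun _ : ι => 𝕜) 2))

theorem isCompactOperator_diagonalOperator {m : lp (fun _ : ι => 𝕜) ∞}
    (hm : Tendsto m cofinite (𝓝 0)) : IsCompactOperator (diagonalOperator m) := by
  classical
  have hsum := (hasSum_single_of_tendsto_cofinite hm).mapL
    (lp.holderL 2 (q := 2) (fun _ => ContinuousLinearMap.mul 𝕜 𝕜) (K := 1) fun _ => by simp)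
  refine isCompactOperator_of_tendsto hsum (Eventually.of_forall fun s => ?_)
  exact (compactOperator (RingHom.id 𝕜) _ _).sum_mem fun i _ =>
    isCompactOperator_diagonalOperator_single i (m i)

end DiagonalOperator

section Sobolev

/-- The weight `(1 + j²)^(p/2)` on the `j`-th Fourier coefficient in the norm of `H^p`. -/
noncomputable def sobolevWeight (p : ℕ) (j : ℤ) : ℝ := √((1 + (j : ℝ) ^ 2) ^ p)

theorem sobolevWeight_pos (p : ℕ) (j : ℤ) : 0 < sobolevWeight p j :=
  Real.sqrt_pos.2 (by positivity)

theorem sobolevWeight_zero (j : ℤ) : sobolevWeight 0 j = 1 := by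
  simp [sobolevWeight]

theorem sobolevWeight_mono {p q : ℕ} (h : p ≤ q) (j : ℤ) : sobolevWeight p j ≤ sobolevWeight q j :=
  Real.sqrt_le_sqrt (pow_le_pow_right₀ (by nlinarith [sq_nonneg (j : ℝ)]) h)

theorem tendsto_sobolevWeight_div {p q : ℕ} (h : p < q) :
    Tendsto (fun j => sobolevWeight p j / sobolevWeight q j) cofinite (𝓝 0) := by
  have hj : Tendsto (fun j : ℤ => 1 + (j : ℝ) ^ 2) cofinite atTop := by
    have habs : Tendsto (fun j : ℤ => ‖(j : ℝ)‖) cofinite atTop :=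
      tendsto_norm_cocompact_atTop.comp Int.tendsto_coe_cofinite
    refine tendsto_atTop_add_const_left _ _ (((tendsto_pow_atTop two_ne_zero).comp habs).congr ?_)
    simp
  have hsqrt := Real.tendsto_sqrt_atTop.comp
    ((tendsto_pow_atTop (Nat.sub_ne_zero_of_lt h)).comp hj)
  refine hsqrt.inv_tendsto_atTop.congr fun j => ?_
  have hpos : (0 : ℝ) < 1 + (j : ℝ) ^ 2 := by positivity
  rw [Pi.inv_apply, Function.comp_apply, Function.comp_apply, sobolevWeight, sobolevWeight,
    ← Real.sqrt_div' _ (by positivity), ← Real.sqrt_inv, pow_sub₀ _ hpos.ne' h.le, mul_inv, inv_inv,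
    div_eq_mul_inv, mul_comm]

theorem mem_sobolev_iff_memℓp {p : ℕ} {h : L2T} :
    h ∈ sobolev p ↔ Memℓp (fun j => (sobolevWeight p j : ℂ) * coeff h j) 2 := by
  rw [mem_sobolev_iff, memℓp_gen_iff (by norm_num)]
  refine summable_congr fun j => ?_
  have hj : (0 : ℝ) ≤ (1 + (j : ℝ) ^ 2) ^ p := by positivity
  simp [sobolevWeight, mul_pow, Real.sq_sqrt hj]

/-- The quotient of the weights of `H^p` and `H^q`, for `p ≤ q`. -/
noncomputable def weightRatio {p q : ℕ} (h : p ≤ q) : lp (fun _ : ℤ => ℂ) ∞ :=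
  ⟨fun j => (sobolevWeight p j / sobolevWeight q j : ℝ), memℓp_infty ⟨1, by
    rintro _ ⟨j, rfl⟩
    simp only [Complex.norm_real, norm_div, Real.norm_of_nonneg (sobolevWeight_pos _ j).le]
    exact div_le_one_of_le₀ (sobolevWeight_mono h j) (sobolevWeight_pos q j).le⟩⟩

theorem weightRatio_apply {p q : ℕ} (h : p ≤ q) (j : ℤ) :
    weightRatio h j = (sobolevWeight p j / sobolevWeight q j : ℝ) := rfl

namespace HSobolev

variable {p q : ℕ}

theorem diagonalOperator_weighted (h : p ≤ q) (w : HSobolev q) (j : ℤ) :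
    diagonalOperator (weightRatio h) (weighted w) j = sobolevWeight p j * coeff (toL2 w) j := by
  have hq : (sobolevWeight q j : ℂ) ≠ 0 := mod_cast (sobolevWeight_pos q j).ne'
  have hw : weighted w j = sobolevWeight q j * coeff (toL2 w) j := rfl
  rw [diagonalOperator_apply, weightRatio_apply, hw, Complex.ofReal_div]
  field_simp

theorem weighted_surjective : Function.Surjective (weighted (p := p)) := by
  intro f
  set g : L2T := (fourierBasis (T := 2 * Real.pi)).repr.symm
    (diagonalOperator (weightRatio (Nat.zero_le p)) f)
  have hg : ∀ j, (sobolevWeight p j : ℂ) * coeff g j = f j := fun j => by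
    have hp : (sobolevWeight p j : ℂ) ≠ 0 := mod_cast (sobolevWeight_pos p j).ne'
    rw [coeff_eq_repr, LinearIsometryEquiv.apply_symm_apply, diagonalOperator_apply,
      weightRatio_apply, sobolevWeight_zero, one_div, Complex.ofReal_inv, mul_inv_cancel_left₀ hp]
  have hmem : g ∈ sobolev p := mem_sobolev_iff_memℓp.2 (by simpa only [hg] using lp.memℓp f)
  exact ⟨(⟨g, hmem⟩ : sobolev p), lp.ext (funext hg)⟩

/-- The weighted Fourier coefficients, as an isometric isomorphism of `H^p` onto `ℓ²`. -/
noncomputable def weightedEquiv (p : ℕ) : HSobolev p ≃ₗᵢ[ℂ] lp (fun _ : ℤ => ℂ) 2 :=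
  LinearIsometryEquiv.ofSurjective ⟨weighted, fun _ => rfl⟩ weighted_surjective

instance : CompleteSpace (HSobolev p) :=
  (weightedEquiv p).toIsometryEquiv.completeSpace

/-- The inclusion of `H^p` into `L²`, as a bounded operator. -/
noncomputable def toL2CLM (p : ℕ) : HSobolev p →L[ℂ] L2T :=
  ((fourierBasis (T := 2 * Real.pi)).repr.symm : lp (fun _ : ℤ => ℂ) 2 →L[ℂ] L2T) ∘L
    diagonalOperator (weightRatio (Nat.zero_le p)) ∘L (weightedEquiv p : HSobolev p →L[ℂ] _)

theorem toL2CLM_apply (w : HSobolev p) : toL2CLM p w = toL2 w := by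
  refine coeff_injective fun j => ?_
  have hrepr : (fourierBasis (T := 2 * Real.pi)).repr (toL2CLM p w) =
      diagonalOperator (weightRatio (Nat.zero_le p)) (weighted w) :=
    LinearIsometryEquiv.apply_symm_apply _ _
  rw [coeff_eq_repr, hrepr, diagonalOperator_weighted, sobolevWeight_zero, Complex.ofReal_one,
    one_mul]

/-- The inclusion of `H^q` into `H^p` for `p ≤ q`, as a bounded operator. -/
noncomputable def inclusion (h : p ≤ q) : HSobolev q →L[ℂ] HSobolev p :=
  ((weightedEquiv p).symm : lp (fun _ : ℤ => ℂ) 2 →L[ℂ] HSobolev p) ∘L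
    diagonalOperator (weightRatio h) ∘L (weightedEquiv q : HSobolev q →L[ℂ] _)

theorem toL2_inclusion (h : p ≤ q) (w : HSobolev q) : toL2 (inclusion h w) = toL2 w := by
  refine coeff_injective fun j => ?_
  have hp : (sobolevWeight p j : ℂ) ≠ 0 := mod_cast (sobolevWeight_pos p j).ne'
  have hweighted : weighted (inclusion h w) = diagonalOperator (weightRatio h) (weighted w) :=
    (weightedEquiv p).apply_symm_apply _
  refine mul_left_cancel₀ hp ?_
  rw [← diagonalOperator_weighted h, ← hweighted]
  rfl

theorem isCompactOperator_inclusion (h : p < q) : IsCompactOperator (inclusion h.le) := by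
  have hlim : Tendsto (weightRatio h.le) cofinite (𝓝 0) := by
    rw [← Complex.ofReal_zero]
    exact (Complex.continuous_ofReal.tendsto 0).comp (tendsto_sobolevWeight_div h)
  have hcompact : IsCompactOperator
      (diagonalOperator (weightRatio h.le) ∘L (weightedEquiv q : HSobolev q →L[ℂ] _)) :=
    (isCompactOperator_diagonalOperator hlim).comp_clm _
  exact hcompact.clm_comp ((weightedEquiv p).symm : lp (fun _ : ℤ => ℂ) 2 →L[ℂ] HSobolev p)

/-- The closed graph theorem: boundedness into `H^q` is automatic. -/
theorem exists_toL2_eq {X : Type*} [NormedAddCommGroup X] [NormedSpace ℂ X] [CompleteSpace X]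
    (f : X →L[ℂ] L2T) (hf : ∀ x, f x ∈ sobolev q) :
    ∃ g : X →L[ℂ] HSobolev q, ∀ x, toL2 (g x) = f x := by
  let g : X →ₗ[ℂ] HSobolev q := (f : X →ₗ[ℂ] L2T).codRestrict (sobolev q) hf
  refine ⟨.ofSeqClosedGraph (g := g) fun u x w hu hgu => ?_, fun x => rfl⟩
  have hw : Tendsto (fun n => f (u n)) atTop (𝓝 (toL2 w)) := by
    rw [← toL2CLM_apply]
    exact (((toL2CLM q).continuous.tendsto w).comp hgu).congr fun n => toL2CLM_apply _
  exact toL2_injective (tendsto_nhds_unique hw ((f.continuous.tendsto x).comp hu))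

end HSobolev

end Sobolev

section FourierMultiplier

theorem coeff_neg (f : L2T) (j : ℤ) : coeff (-f) j = -coeff f j := by
  simp [coeff_eq_repr]

theorem coeff_sub (f g : L2T) (j : ℤ) : coeff (f - g) j = coeff f j - coeff g j := by
  simp [coeff_eq_repr]

theorem memℓp_coeff (f : L2T) : Memℓp (coeff f) 2 := by
  have hcoeff : coeff f = (fourierBasis (T := 2 * Real.pi)).repr f := funext (coeff_eq_repr f)
  exact hcoeff ▸ lp.memℓp _

/-- The operator on `L²` that multiplies the `j`-th Fourier coefficient by `m j`. -/
noncomputable def fourierMultiplier (m : lp (fun _ : ℤ => ℂ) ∞) : L2T →L[ℂ] L2T :=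
  ((fourierBasis (T := 2 * Real.pi)).repr.symm : lp (fun _ : ℤ => ℂ) 2 →L[ℂ] L2T) ∘L
    diagonalOperator m ∘L ((fourierBasis (T := 2 * Real.pi)).repr : L2T →L[ℂ] _)

theorem coeff_fourierMultiplier (m : lp (fun _ : ℤ => ℂ) ∞) (f : L2T) (j : ℤ) :
    coeff (fourierMultiplier m f) j = m j * coeff f j := by
  have hrepr : (fourierBasis (T := 2 * Real.pi)).repr (fourierMultiplier m f) =
      diagonalOperator m ((fourierBasis (T := 2 * Real.pi)).repr f) :=
    LinearIsometryEquiv.apply_symm_apply _ _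
  rw [coeff_eq_repr, hrepr, diagonalOperator_apply, coeff_eq_repr]

theorem norm_fourierMultiplier_le (m : lp (fun _ : ℤ => ℂ) ∞) : ‖fourierMultiplier m‖ ≤ ‖m‖ := by
  refine ContinuousLinearMap.opNorm_le_bound _ (norm_nonneg m) fun f => ?_
  calc ‖fourierMultiplier m f‖
      = ‖diagonalOperator m ((fourierBasis (T := 2 * Real.pi)).repr f)‖ :=
        (fourierBasis (T := 2 * Real.pi)).repr.symm.norm_map _
    _ ≤ ‖m‖ * ‖f‖ := by
        rw [← (fourierBasis (T := 2 * Real.pi)).repr.norm_map f]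
        exact ContinuousLinearMap.le_of_opNorm_le _ (norm_diagonalOperator_le m) _

open scoped ComplexOrder in
theorem fourierMultiplier_nonneg {m : lp (fun _ : ℤ => ℂ) ∞} (hm : ∀ j, 0 ≤ (m j : ℂ)) :
    0 ≤ fourierMultiplier m := by
  have hpos := ContinuousLinearMap.nonneg_iff_isPositive _ |>.1 (diagonalOperator_nonneg hm)
  have hconj := hpos.conj_adjoint
    ((fourierBasis (T := 2 * Real.pi)).repr.symm : lp (fun _ : ℤ => ℂ) 2 →L[ℂ] L2T)
  rw [LinearIsometryEquiv.adjoint_eq_symm] at hconj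
  exact (ContinuousLinearMap.nonneg_iff_isPositive _).2 hconj

end FourierMultiplier

section FreeResolvent

variable {μ : ℝ} (hμ : 0 < μ) (m : ℤ → ℝ)

include hμ in
theorem norm_inv_add_sq_le (j : ℤ) : ‖((μ + m j ^ 2 : ℝ) : ℂ)⁻¹‖ ≤ μ⁻¹ := by
  rw [norm_inv, Complex.norm_real, Real.norm_of_nonneg (by positivity)]
  gcongr
  exact le_add_of_nonneg_right (sq_nonneg (m j))

/-- The resolvent at `μ` of the Fourier multiplier with symbol `-m²`. -/
noncomputable def freeResolvent : L2T →L[ℂ] L2T :=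
  fourierMultiplier ⟨fun j => ((μ + m j ^ 2 : ℝ) : ℂ)⁻¹,
    memℓp_infty ⟨μ⁻¹, Set.forall_mem_range.2 (norm_inv_add_sq_le hμ m)⟩⟩

theorem norm_freeResolvent_le : ‖freeResolvent hμ m‖ ≤ μ⁻¹ :=
  (norm_fourierMultiplier_le _).trans
    (lp.norm_le_of_forall_le (inv_nonneg.2 hμ.le) (norm_inv_add_sq_le hμ m))

open scoped ComplexOrder in
theorem freeResolvent_nonneg : 0 ≤ freeResolvent hμ m :=
  fourierMultiplier_nonneg fun j =>
    inv_nonneg.2 (Complex.zero_le_real.2 (add_nonneg hμ.le (sq_nonneg (m j))))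

theorem freeResolvent_apply_eq_iff (g x : L2T) :
    freeResolvent hμ m g = x ↔ ∀ j, ((μ + m j ^ 2 : ℝ) : ℂ) * coeff x j = coeff g j := by
  have hne (j : ℤ) : ((μ + m j ^ 2 : ℝ) : ℂ) ≠ 0 :=
    Complex.ofReal_ne_zero.2 (add_pos_of_pos_of_nonneg hμ (sq_nonneg (m j))).ne'
  have hcoeff (j : ℤ) : coeff (freeResolvent hμ m g) j = ((μ + m j ^ 2 : ℝ) : ℂ)⁻¹ * coeff g j :=
    coeff_fourierMultiplier _ g j
  constructor
  · rintro rfl j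
    rw [hcoeff, mul_inv_cancel_left₀ (hne j)]
  · intro h
    exact coeff_injective fun j => by rw [hcoeff, ← h j, inv_mul_cancel_left₀ (hne j)]

theorem freeResolvent_injective : Function.Injective (freeResolvent hμ m) := by
  intro f g hfg
  refine coeff_injective fun j => ?_
  rw [← (freeResolvent_apply_eq_iff hμ m f _).1 hfg j,
    (freeResolvent_apply_eq_iff hμ m g _).1 rfl j]

theorem freeResolvent_mem_sobolev {p : ℕ} {C : ℝ}
    (hC : ∀ j, sobolevWeight p j ≤ C * (μ + m j ^ 2)) (g : L2T) :
    freeResolvent hμ m g ∈ sobolev p := by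
  refine mem_sobolev_iff_memℓp.2 (((memℓp_coeff g).const_mul (C : ℂ)).mono' fun j => ?_)
  rw [← (freeResolvent_apply_eq_iff hμ m g _).1 rfl j, ← mul_assoc, norm_mul, norm_mul,
    ← Complex.ofReal_mul, Complex.norm_real, Complex.norm_real]
  gcongr
  rw [Real.norm_of_nonneg (sobolevWeight_pos p j).le]
  exact (hC j).trans (le_abs_self _)

end FreeResolvent

section BlochOperator

theorem isSelfAdjoint_mulOp {F : C(Torus, ℂ)} (hF : IsSelfAdjoint F) :
    IsSelfAdjoint (mulOp F) := by
  rw [ContinuousLinearMap.isSelfAdjoint_iff_isSymmetric]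
  intro f g
  change inner ℂ (mulOp F f) g = inner ℂ f (mulOp F g)
  rw [L2.inner_def, L2.inner_def]
  refine integral_congr_ae ?_
  filter_upwards [coeFn_mulOp F f, coeFn_mulOp F g] with x hf hg
  have hx : (starRingEnd ℂ) (F x) = F x := DFunLike.congr_fun hF x
  rw [hf, hg, RCLike.inner_apply, RCLike.inner_apply, map_mul, hx]
  ring

theorem Roll.isSelfAdjoint_potential {ε ω b s : ℝ} (u : Roll ε ω b s) :
    IsSelfAdjoint u.potential := by
  ext x
  induction x using QuotientAddGroup.induction_on with
  | H x => exact Complex.conj_ofReal _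

/-- The operator `-[1 + (1 + 2 ε ω) (∂ₓ + i σ₁)² - σ₂²]² + V` on `L²`, with domain `H⁴`;
`blochOperator u σ` is the case where `V` is the multiplication by `u.potential`. -/
noncomputable def swiftHohenbergOperator (ε ω : ℝ) (σ : ℝ × ℝ) (V : L2T →L[ℂ] L2T) :
    L2T →ₗ.[ℂ] L2T where
  domain := sobolev 4
  toFun := -((sobolev 0).subtype ∘ₗ blochRoot ε ω σ 0 ∘ₗ blochRoot ε ω σ 2)
    + (V : L2T →ₗ[ℂ] L2T) ∘ₗ (sobolev 4).subtype

/-- The Fourier symbol of `1 + (1 + 2 ε ω) (∂ₓ + i σ₁)² - σ₂²`. -/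
def blochSymbol (ε ω : ℝ) (σ : ℝ × ℝ) (j : ℤ) : ℝ :=
  1 - (1 + 2 * ε * ω) * (j + σ.1) ^ 2 - σ.2 ^ 2

theorem coeff_covDeriv (σ₁ : ℝ) (p : ℕ) (f : sobolev (p + 1)) (j : ℤ) :
    coeff (covDeriv σ₁ p f) j = Complex.I * (j + σ₁) * coeff f j := by
  have hf : (covDeriv σ₁ p f : L2T) = derivL2 f + (Complex.I * σ₁) • (f : L2T) := rfl
  rw [hf, coeff_add, coeff_derivL2, coeff_smul]
  ring

theorem coeff_blochRoot (ε ω : ℝ) (σ : ℝ × ℝ) (p : ℕ) (f : sobolev (p + 2)) (j : ℤ) :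
    coeff (blochRoot ε ω σ p f) j = blochSymbol ε ω σ j * coeff f j := by
  have hf : (blochRoot ε ω σ p f : L2T) = f
      + ((1 + 2 * ε * ω : ℝ) : ℂ) • (covDeriv σ.1 p (covDeriv σ.1 (p + 1) f) : L2T)
      - ((σ.2 ^ 2 : ℝ) : ℂ) • (f : L2T) := rfl
  rw [hf, coeff_sub, coeff_add, coeff_smul, coeff_smul, coeff_covDeriv, coeff_covDeriv, blochSymbol]
  push_cast
  linear_combination (1 + 2 * (ε : ℂ) * ω) * (j + σ.1) ^ 2 * coeff f j * Complex.I_sq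

theorem coeff_swiftHohenbergOperator (ε ω : ℝ) (σ : ℝ × ℝ) (V : L2T →L[ℂ] L2T) (f : sobolev 4)
    (j : ℤ) : coeff (swiftHohenbergOperator ε ω σ V f) j =
      -(blochSymbol ε ω σ j : ℂ) ^ 2 * coeff f j + coeff (V f) j := by
  have hf : swiftHohenbergOperator ε ω σ V f =
      -(blochRoot ε ω σ 0 (blochRoot ε ω σ 2 f) : L2T) + V f := rfl
  rw [hf, coeff_add, coeff_neg, coeff_blochRoot, coeff_blochRoot]
  ring

variable {ε ω : ℝ}

theorem exists_sobolevWeight_le_mul_add_blochSymbol_sq (hk : 1 + 2 * ε * ω ≠ 0) (σ : ℝ × ℝ)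
    {μ : ℝ} (hμ : 0 < μ) : ∃ C, ∀ j, sobolevWeight 4 j ≤ C * (μ + blochSymbol ε ω σ j ^ 2) := by
  set k := 1 + 2 * ε * ω with hk_def
  set α := 1 + 2 * σ.1 ^ 2 + 2 * (1 + σ.2 ^ 2) / |k|
  set β := 2 / |k|
  refine ⟨2 * (α ^ 2 / μ + β ^ 2), fun j => ?_⟩
  set m := blochSymbol ε ω σ j with hm
  have hjσ : (j + σ.1) ^ 2 ≤ (1 + σ.2 ^ 2 + |m|) / |k| := by
    rw [le_div_iff₀ (abs_pos.2 hk)]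
    calc (j + σ.1) ^ 2 * |k| = |1 - σ.2 ^ 2 - m| := by
          rw [← abs_of_nonneg (sq_nonneg (j + σ.1)), ← abs_mul, hm, blochSymbol, ← hk_def]
          congr 1
          ring
      _ ≤ 1 + σ.2 ^ 2 + |m| := by
          rw [abs_le]
          constructor <;> linarith [neg_abs_le m, le_abs_self m, sq_nonneg σ.2]
  have hj : 1 + (j : ℝ) ^ 2 ≤ α + β * |m| := by
    have hsplit : α + β * |m| = 1 + 2 * σ.1 ^ 2 + 2 * ((1 + σ.2 ^ 2 + |m|) / |k|) := by ring
    nlinarith [sq_nonneg (j + 2 * σ.1)]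
  have hweight : sobolevWeight 4 j = (1 + (j : ℝ) ^ 2) ^ 2 := by
    rw [sobolevWeight, show 4 = 2 * 2 from rfl, pow_mul, Real.sqrt_sq (by positivity)]
  calc sobolevWeight 4 j ≤ (α + β * |m|) ^ 2 := by rw [hweight]; gcongr
    _ ≤ 2 * (α ^ 2 + (β * |m|) ^ 2) := add_sq_le
    _ = 2 * (α ^ 2 / μ * μ + β ^ 2 * m ^ 2) := by
        rw [mul_pow, sq_abs, div_mul_cancel₀ _ hμ.ne']
    _ ≤ 2 * (α ^ 2 / μ + β ^ 2) * (μ + m ^ 2) := by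
        have hα : 0 ≤ α ^ 2 / μ * m ^ 2 := by positivity
        have hβ : 0 ≤ β ^ 2 * μ := by positivity
        linarith

theorem mem_graph_swiftHohenbergOperator_iff (hk : 1 + 2 * ε * ω ≠ 0) (σ : ℝ × ℝ)
    (V : L2T →L[ℂ] L2T) {μ : ℝ} (hμ : 0 < μ) (x y : L2T) :
    (x, y) ∈ (swiftHohenbergOperator ε ω σ V).graph ↔
      freeResolvent hμ (blochSymbol ε ω σ) ((μ : ℂ) • x - y + V x) = x := by
  rw [LinearPMap.mem_graph_iff, freeResolvent_apply_eq_iff]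
  have hcoeff (j : ℤ) : ((μ + blochSymbol ε ω σ j ^ 2 : ℝ) : ℂ) * coeff x j =
      coeff ((μ : ℂ) • x - y + V x) j ↔
        -(blochSymbol ε ω σ j : ℂ) ^ 2 * coeff x j + coeff (V x) j = coeff y j := by
    rw [coeff_add, coeff_sub, coeff_smul, Complex.ofReal_add, Complex.ofReal_pow]
    constructor <;> intro h <;> linear_combination -h
  simp only [hcoeff]
  constructor
  · rintro ⟨f, rfl, rfl⟩ j
    exact (coeff_swiftHohenbergOperator ε ω σ V f j).symm
  · intro h
    obtain ⟨C, hC⟩ := exists_sobolevWeight_le_mul_add_blochSymbol_sq hk σ hμ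
    have hx : x ∈ sobolev 4 := by
      rw [← (freeResolvent_apply_eq_iff hμ _ _ x).2 fun j => (hcoeff j).2 (h j)]
      exact freeResolvent_mem_sobolev hμ _ hC _
    exact ⟨⟨x, hx⟩, rfl, coeff_injective fun j =>
      (coeff_swiftHohenbergOperator ε ω σ V ⟨x, hx⟩ j).trans (h j)⟩

theorem exists_resolvent_swiftHohenbergOperator (hk : 1 + 2 * ε * ω ≠ 0) (σ : ℝ × ℝ)
    {V : L2T →L[ℂ] L2T} (hV : IsSelfAdjoint V) {μ : ℝ} (hμ : ‖V‖ < μ) :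
    ∃ R : L2T →L[ℂ] L2T, 0 ≤ R ∧ Function.Injective R ∧
      ∀ x y, (x, y) ∈ (swiftHohenbergOperator ε ω σ V).graph ↔ R ((μ : ℂ) • x - y) = x := by
  have hμ₀ : 0 < μ := (norm_nonneg V).trans_lt hμ
  have hsmall : ‖V‖ * ‖freeResolvent hμ₀ (blochSymbol ε ω σ)‖ < 1 :=
    calc ‖V‖ * ‖freeResolvent hμ₀ (blochSymbol ε ω σ)‖ ≤ ‖V‖ * μ⁻¹ := by
          gcongr
          exact norm_freeResolvent_le hμ₀ _
      _ < 1 := by rwa [← div_eq_mul_inv, div_lt_one hμ₀]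
  obtain ⟨R, hR, hl, hr⟩ :=
    exists_nonneg_eq_add_mul_mul (freeResolvent_nonneg hμ₀ (blochSymbol ε ω σ)) hV hsmall
  refine ⟨R, hR, (injective_iff_map_eq_zero R).2 fun y hy => ?_, fun x y => ?_⟩
  · have hy' := (apply_eq_iff_of_eq_add_mul_mul hl hr).1 hy
    rw [map_zero, add_zero] at hy'
    exact (injective_iff_map_eq_zero _).1 (freeResolvent_injective hμ₀ _) y hy'
  · rw [mem_graph_swiftHohenbergOperator_iff hk σ V hμ₀, apply_eq_iff_of_eq_add_mul_mul hl hr]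

end BlochOperator

end SwiftHohenberg

open SwiftHohenberg in
theorem lemma3p1_general {ε ω : ℝ} (hk : 1 + 2 * ε * ω ≠ 0) (σ : ℝ × ℝ) {V : L2T →L[ℂ] L2T}
    (hV : IsSelfAdjoint V) {p : ℕ} (hp : p < 4) :
    (∃! S : ℝ≥0 → L2T →L[ℂ] L2T, IsSemigroupGeneratedBy S (swiftHohenbergOperator ε ω σ V)) ∧
    ∀ S : ℝ≥0 → L2T →L[ℂ] L2T, IsSemigroupGeneratedBy S (swiftHohenbergOperator ε ω σ V) →
      ∀ T : ℝ≥0, 0 < T →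
        ∃ K : L2T →L[ℂ] HSobolev p, (∀ f, HSobolev.toL2 (K f) = S T f) ∧ IsCompactOperator K := by
  obtain ⟨R, hR, hinj, hgraph⟩ :=
    exists_resolvent_swiftHohenbergOperator hk σ hV (lt_add_one ‖V‖)
  refine ⟨existsUnique_isSemigroupGeneratedBy hR hinj hgraph, fun S hS T hT => ?_⟩
  obtain ⟨K, hK⟩ := HSobolev.exists_toL2_eq (S T) (hS.apply_mem_domain hR hinj hgraph hT)
  refine ⟨HSobolev.inclusion hp.le ∘L K, fun f => ?_,
    (HSobolev.isCompactOperator_inclusion hp).comp_clm K⟩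
  exact (HSobolev.toL2_inclusion hp.le (K f)).trans (hK f)

theorem lemma3p1 (ε ω b s : ℝ) (hk : 0 < 1 + 2 * ε * ω)
    (u : SwiftHohenberg.Roll ε ω b s) (σ : ℝ × ℝ) :
    (∃! S : ℝ≥0 → SwiftHohenberg.L2T →L[ℂ] SwiftHohenberg.L2T,
      SwiftHohenberg.IsSemigroupGeneratedBy S (SwiftHohenberg.blochOperator u σ)) ∧
    ∀ S : ℝ≥0 → SwiftHohenberg.L2T →L[ℂ] SwiftHohenberg.L2T,
      SwiftHohenberg.IsSemigroupGeneratedBy S (SwiftHohenberg.blochOperator u σ) →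
      ∀ T : ℝ≥0, 0 < T →
        ∃ K : SwiftHohenberg.HSobolev 2 →L[ℂ] SwiftHohenberg.HSobolev 2,
          (∀ w : SwiftHohenberg.HSobolev 2,
            SwiftHohenberg.HSobolev.toL2 (K w) = S T (SwiftHohenberg.HSobolev.toL2 w)) ∧
          IsCompactOperator K :=
  (lemma3p1_general hk.ne' σ (SwiftHohenberg.isSelfAdjoint_mulOp u.isSelfAdjoint_potential)
    (by norm_num : 2 < 4)).imp_right fun h S hS T hT =>
      let ⟨K, hK, hKc⟩ := h S hS T hT
      ⟨K ∘L SwiftHohenberg.HSobolev.toL2CLM 2,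
        fun w => by simp [hK, SwiftHohenberg.HSobolev.toL2CLM_apply], hKc.comp_clm _⟩
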